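/- **Definitions.** An *AQS automaton* consists of a finite set $S$ of states, maps $F^-,F^+:S\to\mathbb R\cup\{-\infty,+\infty\}$ and maps $U,D:S\to S$ such that for all $\sigma\in S$: $F^-[\sigma]<F^+[\sigma]$; $F^+[U\sigma]>F^+[\sigma]$ if $U\sigma\ne\sigma$; $F^-[U\sigma]<F^+[\sigma]$; $F^-[D\sigma]<F^-[\sigma]$ if $D\sigma\neq\sigma$; $F^+[D\sigma]>F^-[\sigma]$. Moreover $U$ has precisely one fixed point $\omega$, $D$ has precisely one fixed point $\alpha$, and $F^+[\omega]=+\infty$, $F^-[\alpha]=-\infty$. Let $U^*\sigma=\{U^i\sigma: i\ge 0\}$ and $D^*\sigma=\{D^i\sigma: i\ge 0\}$. Write $\mu\prec_U\nu$ if $\nu\in U^*\mu$ and $\mu\ne\nu$; $\mu\prec_D\nu$ if $\mu\in D^*\nu$ and $\mu\neq\nu$; and $\mu<\nu$ if both $\mu\prec_U\nu$ and $\mu\prec_D\nu$. The automaton is an *$\ell$AQS automaton* if it has the loop return point memory property: for all states with $\mu<\nu$, $\mu\prec_U\sigma\prec_U\nu$ implies $\mu<\sigma$, and $\mu\prec_D\sigma\prec_D\nu$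 implies $\sigma<\nu$. A pair $(\mu,\nu)$ is a *loop* if $\nu\in U^*\mu$ and $\mu\in D^*\nu$ (the singleton loop $\mu=\nu$ is allowed). A *$(\mu,\nu)$-confined field-history* is a finite, possibly empty, sequence of applications of $U$ and $D$ that starts from $\mu$ or from $\nu$, whose first step (if any) is not $U$ if it starts from $\nu$ and not $D$ if it starts from $\mu$, and all of whose states strictly between the initial and the final one differ from $\mu$ and $\nu$. (For $\mu=\nu$ only the empty field-history is confined.) The set $\mathcal R_{\mu,\nu}$ of *$(\mu,\nu)$-reachable states* is the set of final states of $(\mu,\nu)$-confined field-histories. The *state transition graph* on $\mathcal R_{\mu,\nu}$ is the multigraph with vertex set $\mathcal R_{\mu,\nu}$ that has, for each $\sigma\in\mathcal R_{\mu,\nu}$, one edge from $\sigma$ to $U\sigma$ if $U\sigma\in\mathcal R_{\mu,\nu}$, and one edge from $\sigma$ to $D\sigma$ if $D\sigma\in\mathcal R_{\mu,\nu}$. A multigraph is *planar* if it can be drawn in the Euclidean plane with vertices as distinct points and edges as simple arcs (simple closed curves for edges from a vertex to itself) joining their ends, so that the interior of an edge contains no vertex and meets no other edge. **Theorem (Planarity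 of the state transition graph associated with a loop).** Let $(\mu,\nu)$ be a loop of an $\ell$AQS automaton. Then the state transition graph on the set $\mathcal R_{\mu,\nu}$ of $(\mu,\nu)$-reachable states is planar. -/

import Mathlib

/-- An AQS automaton `(S, F⁻, F⁺, U, D)`: a finite set of configurations with trapping fields and
the transition maps `U` (field increase) and `D` (field decrease), compatible with each other.
Each of the two maps has precisely one fixed point, the absorbing states `omega` and `alpha`. -/
structure AQSAutomaton (S : Type*) where
  finite : Finite S
  Fminus : S → EReal
  Fplus : S → EReal
  U : S → S
  D : S → S
  Fminus_lt_Fplus : ∀ σ, Fminus σ < Fplus σ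
  Fplus_lt_Fplus_U : ∀ σ, U σ ≠ σ → Fplus σ < Fplus (U σ)
  Fminus_U_lt_Fplus : ∀ σ, Fminus (U σ) < Fplus σ
  Fminus_D_lt_Fminus : ∀ σ, D σ ≠ σ → Fminus (D σ) < Fminus σ
  Fminus_lt_Fplus_D : ∀ σ, Fminus σ < Fplus (D σ)
  omega : S
  alpha : S
  U_eq_self_iff : ∀ σ, U σ = σ ↔ σ = omega
  D_eq_self_iff : ∀ σ, D σ = σ ↔ σ = alpha
  Fplus_omega : Fplus omega = ⊤
  Fminus_alpha : Fminus alpha = ⊥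

/-- The two kinds of transitions. -/
inductive AQSStep
  | up
  | down

namespace AQSAutomaton

variable {S : Type*} (A : AQSAutomaton S)

/-- The `U`-orbit `U^*σ`, as a set. -/
def orbitU (σ : S) : Set S := {η | ∃ i : ℕ, η = A.U^[i] σ}

/-- The `D`-orbit `D^*σ`, as a set. -/
def orbitD (σ : S) : Set S := {η | ∃ i : ℕ, η = A.D^[i] σ}

/-- The dynamic order `μ ⪯_U ν`. -/
def leU (μ ν : S) : Prop := ν ∈ A.orbitU μ

/-- The dynamic order `μ ⪯_D ν`. -/
def leD (μ ν : S) : Prop := μ ∈ A.orbitD ν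

/-- The strict dynamic order `μ ≺_U ν`. -/
def ltU (μ ν : S) : Prop := A.leU μ ν ∧ μ ≠ ν

/-- The strict dynamic order `μ ≺_D ν`. -/
def ltD (μ ν : S) : Prop := A.leD μ ν ∧ μ ≠ ν

/-- The loop partial order `μ < ν`. -/
def loopLt (μ ν : S) : Prop := A.ltU μ ν ∧ A.ltD μ ν

/-- The loop return point memory property (ℓRPM). -/
def HasLoopRPM : Prop :=
  ∀ μ ν σ : S, A.loopLt μ ν →
    (A.ltU μ σ → A.ltU σ ν → A.loopLt μ σ) ∧ (A.ltD μ σ → A.ltD σ ν → A.loopLt σ ν)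

/-- `(μ, ν)` are the endpoints of a loop. The case `μ = ν` is the singleton loop. -/
def IsLoop (μ ν : S) : Prop := ν ∈ A.orbitU μ ∧ μ ∈ A.orbitD ν

/-- The transition of a given kind out of a state. -/
def step : AQSStep → S → S
  | .up => A.U
  | .down => A.D

/-- The final state of a field-history, a finite sequence of `U`- and `D`-transitions applied from
left to right, that starts in `σ`. -/
def run (Φ : List AQSStep) (σ : S) : S := Φ.foldl (fun x s => A.step s x) σ

/-- `Φ` is a `(μ, ν)`-confined field-history starting from the endpoint `ε` of the loop `(μ, ν)`:
its transit states (those strictly between the initial and the final one) avoid `μ` and `ν`.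
A field-history starting from the lower endpoint `μ` begins with `U`, one starting from the upper
endpoint `ν` begins with `D`; thus `ν` is never left by `U`, nor `μ` by `D`. On a singleton loop
this leaves only the empty field-history. -/
def IsConfinedHistory (μ ν ε : S) (Φ : List AQSStep) : Prop :=
  (ε = μ ∨ ε = ν) ∧
  (Φ.head? = some .up → ε ≠ ν) ∧
  (Φ.head? = some .down → ε ≠ μ) ∧
  ∀ k : ℕ, 0 < k → k < Φ.length → A.run (Φ.take k) ε ≠ μ ∧ A.run (Φ.take k) ε ≠ ν

/-- The set `R_{μ,ν}` of `(μ, ν)`-reachable states. -/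
def reachable (μ ν : S) : Set S :=
  {σ | ∃ (ε : S) (Φ : List AQSStep), A.IsConfinedHistory μ ν ε Φ ∧ A.run Φ ε = σ}

/-- The state transition graph on a set `R` of states, as a multigraph: its vertices are the states
in `R`, and it has one edge from `σ` to `U σ` and one edge from `σ` to `D σ` for every `σ ∈ R`
for which that target is in `R` too. The edge `(σ, s)` is the transition of kind `s` out of `σ`. -/
def transitionGraph (R : Set S) : Graph S (S × AQSStep) where
  vertexSet := R
  IsLink e x y := x ∈ R ∧ y ∈ R ∧
    ((x = e.1 ∧ y = A.step e.2 e.1) ∨ (y = e.1 ∧ x = A.step e.2 e.1))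
  isLink_symm _ _ := ⟨fun _ _ h => ⟨h.2.1, h.1, h.2.2.symm⟩⟩
  eq_or_eq_of_isLink_of_isLink := by
    rintro e x y v w ⟨-, -, h⟩ ⟨-, -, h'⟩
    rcases h with ⟨h1, h2⟩ | ⟨h1, h2⟩ <;> rcases h' with ⟨h3, h4⟩ | ⟨h3, h4⟩ <;> simp_all
  left_mem_of_isLink := fun _ _ _ h => h.1

end AQSAutomaton

/-- A drawing of a multigraph in the Euclidean plane without crossings. Vertices are distinct points
and every edge is a continuous curve joining the points of its ends. The interior of an edge contains
no vertex and does not meet itself or the interior of another edge. Hence edges with distinct ends are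
simple arcs, and edges from a vertex to itself are simple closed curves. -/
structure PlaneDrawing {α β : Type*} (G : Graph α β) where
  point : α → EuclideanSpace ℝ (Fin 2)
  curve : β → C(unitInterval, EuclideanSpace ℝ (Fin 2))
  point_injOn : Set.InjOn point G.vertexSet
  curve_ends : ∀ e ∈ G.edgeSet, ∃ x y, G.IsLink e x y ∧ curve e 0 = point x ∧ curve e 1 = point y
  curve_ne_point : ∀ e ∈ G.edgeSet, ∀ t ∈ Set.Ioo (0 : unitInterval) 1, ∀ x ∈ G.vertexSet,
    curve e t ≠ point x
  curve_inj : ∀ e ∈ G.edgeSet, ∀ f ∈ G.edgeSet,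
    ∀ s ∈ Set.Ioo (0 : unitInterval) 1, ∀ t ∈ Set.Ioo (0 : unitInterval) 1,
      curve e s = curve f t → e = f ∧ s = t

/-- A multigraph is planar if it can be drawn in the plane without crossings. -/
def Graph.IsPlanar {α β : Type*} (G : Graph α β) : Prop := Nonempty (PlaneDrawing G)

/-! A loop splits into two smaller loops. Let `π` be the predecessor of `ν` on the `U`-orbit of `μ`;
by ℓRPM `(μ, π)` is a loop, and induction gives a ranked set `T` for it. Let `κ` be the state from
which the `D`-orbit of `ν` first enters `T`; again by ℓRPM `(κ, ν)` is a loop, with a ranked set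
`T'` disjoint from `T`.

Place `T'` to the right of `T` on a line. Only two arcs join the blocks. The `U`-arc from `π` to `ν`
spans all of `T'`. The `D`-arc from `κ` ends at a state on the `D`-orbit of `π`, which no `D`-arc of
`T` covers. Hence neither page acquires a crossing (`append`, `exists_isBookRanking`). Arcs are then
realised as parabolas and fixed points as closed curves beyond the two ends (`isPlanar`). Since `T`
need only contain the reachable states, closure of `T` under confined steps suffices
(`reachable_subset`). -/

theorem exists_iterate_entry {S : Type*} (f : S → S) (T : Set S) (n : ℕ) (x : S) (hx : x ∉ T)
    (h : f^[n] x ∈ T) : ∃ i j : ℕ, f^[i] x ∉ T ∧ f (f^[i] x) ∈ T ∧ i + 1 + j = n := by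
  induction n generalizing x with
  | zero => exact absurd h hx
  | succ n ih =>
    rw [Function.iterate_succ_apply] at h
    by_cases hfx : f x ∈ T
    · exact ⟨0, n, hx, hfx, by omega⟩
    · obtain ⟨i, j, h1, h2, h3⟩ := ih _ hfx h
      exact ⟨i + 1, j, h1, h2, by omega⟩

namespace AQSAutomaton

variable {S : Type*} {A : AQSAutomaton S}

theorem leU_refl (a : S) : A.leU a a := ⟨0, rfl⟩

theorem leD_refl (a : S) : A.leD a a := ⟨0, rfl⟩

theorem leU_of_leU_U {a b : S} (h : A.leU (A.U a) b) : A.leU a b := by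
  obtain ⟨i, rfl⟩ := h
  exact ⟨i + 1, rfl⟩

theorem leD_of_leD_D {a b : S} (h : A.leD b (A.D a)) : A.leD b a := by
  obtain ⟨i, rfl⟩ := h
  exact ⟨i + 1, rfl⟩

theorem leU_U (a : S) : A.leU a (A.U a) := ⟨1, rfl⟩

theorem leD.trans {a b c : S} (h : A.leD a b) (h' : A.leD b c) : A.leD a c := by
  obtain ⟨j, rfl⟩ := h'
  obtain ⟨i, rfl⟩ := h
  exact ⟨i + j, (Function.iterate_add_apply _ _ _ _).symm⟩

/-- Each `U`-step raises `Fplus` unless it is at a fixed point. This yields antisymmetry of the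
order and half of the induction measure. -/
theorem ltU.Fplus_lt {a b : S} (h : A.ltU a b) : A.Fplus a < A.Fplus b := by
  obtain ⟨⟨i, rfl⟩, hne⟩ := h
  have key : ∀ i : ℕ, A.Fplus a ≤ A.Fplus (A.U^[i] a) ∧
      (a ≠ A.U^[i] a → A.Fplus a < A.Fplus (A.U^[i] a)) := by
    intro i
    induction i with
    | zero => exact ⟨le_rfl, fun h => absurd rfl h⟩
    | succ i ih =>
      rw [Function.iterate_succ_apply']
      by_cases hf : A.U (A.U^[i] a) = A.U^[i] a
      · rwa [hf]
      · have := ih.1.trans_lt (A.Fplus_lt_Fplus_U _ hf)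
        exact ⟨this.le, fun _ => this⟩
  exact (key i).2 hne

theorem ltD.Fminus_lt {a b : S} (h : A.ltD a b) : A.Fminus a < A.Fminus b := by
  obtain ⟨⟨i, rfl⟩, hne⟩ := h
  have key : ∀ i : ℕ, A.Fminus (A.D^[i] b) ≤ A.Fminus b ∧
      (A.D^[i] b ≠ b → A.Fminus (A.D^[i] b) < A.Fminus b) := by
    intro i
    induction i with
    | zero => exact ⟨le_rfl, fun h => absurd rfl h⟩
    | succ i ih =>
      rw [Function.iterate_succ_apply']
      by_cases hf : A.D (A.D^[i] b) = A.D^[i] b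
      · rwa [hf]
      · have := (A.Fminus_D_lt_Fminus _ hf).trans_le ih.1
        exact ⟨this.le, fun _ => this⟩
  exact (key i).2 hne

theorem leU.antisymm {a b : S} (h : A.leU a b) (h' : A.leU b a) : a = b := by
  by_contra hne
  exact lt_asymm (ltU.Fplus_lt ⟨h, hne⟩) (ltU.Fplus_lt ⟨h', Ne.symm hne⟩)

theorem leD.antisymm {a b : S} (h : A.leD a b) (h' : A.leD b a) : a = b := by
  by_contra hne
  exact lt_asymm (ltD.Fminus_lt ⟨h, hne⟩) (ltD.Fminus_lt ⟨h', Ne.symm hne⟩)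

/-! ### Book rankings and their concatenation -/

/-- A ranking `r` of a set `T` of states that contains the endpoints `μ`, `ν` and is closed under the
transitions that do not leave `μ` downwards or `ν` upwards. The `U`-transitions increase the rank
and pairwise do not cross, the `D`-transitions decrease the rank and pairwise do not cross: drawn as
arcs above and below a line, they form a two-page book embedding. -/
structure IsBookRanking (A : AQSAutomaton S) (μ ν : S) (T : Set S) (r : S → ℕ) : Prop where
  bot_mem : μ ∈ T
  top_mem : ν ∈ T
  injOn : Set.InjOn r T
  bot_le : ∀ a ∈ T, r μ ≤ r a
  le_top : ∀ a ∈ T, r a ≤ r ν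
  U_mem : ∀ a ∈ T, a ≠ ν → A.U a ∈ T
  lt_U : ∀ a ∈ T, a ≠ ν → r a < r (A.U a)
  D_mem : ∀ a ∈ T, a ≠ μ → A.D a ∈ T
  D_lt : ∀ a ∈ T, a ≠ μ → r (A.D a) < r a
  U_le_U : ∀ a ∈ T, ∀ b ∈ T, a ≠ ν → r a < r b → r b < r (A.U a) → r (A.U b) ≤ r (A.U a)
  D_le_D : ∀ a ∈ T, ∀ b ∈ T, a ≠ μ → r b < r a → r (A.D a) < r b → r (A.D a) ≤ r (A.D b)

theorem isBookRanking_singleton (μ : S) : A.IsBookRanking μ μ {μ} (fun _ => 0) := by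
  constructor <;> simp

namespace IsBookRanking

variable {μ ν : S} {T : Set S} {r : S → ℕ}

theorem leU_top (h : A.IsBookRanking μ ν T r) {a : S} (ha : a ∈ T) : A.leU a ν := by
  by_cases hne : a = ν
  · exact hne ▸ leU_refl _
  · have h1 := h.lt_U a ha hne
    have h2 := h.le_top _ (h.U_mem a ha hne)
    exact leU_of_leU_U (h.leU_top (h.U_mem a ha hne))
termination_by r ν - r a

theorem bot_leD (h : A.IsBookRanking μ ν T r) {a : S} (ha : a ∈ T) : A.leD μ a := by
  by_cases hne : a = μ
  · exact hne ▸ leD_refl _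
  · have h1 := h.D_lt a ha hne
    exact leD_of_leD_D (h.bot_leD (h.D_mem a ha hne))
termination_by r a

/-- The ranking does not constrain `U ν`. If this transition is an edge at all, it is a fixed-point
loop at the right end of the line. -/
theorem U_top_eq (h : A.IsBookRanking μ ν T r) (hU : A.U ν ∈ T) : A.U ν = ν :=
  leU.antisymm (h.leU_top hU) (leU_U ν)

theorem D_bot_eq (h : A.IsBookRanking μ ν T r) (hD : A.D μ ∈ T) : A.D μ = μ :=
  leD.antisymm ⟨1, rfl⟩ (h.bot_leD hD)

/-- The states on the `D`-orbit of the upper endpoint are not covered by `D`-arcs. -/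
theorem le_D_of_lt (h : A.IsBookRanking μ ν T r) {τ : S} (hτ : τ ∈ T) (n : ℕ)
    {x : S} (hx : x ∈ T) (hn : τ = A.D^[n] x) {b : S} (hb : b ∈ T)
    (hbx : r b ≤ r x) (hlt : r τ < r b) : r τ ≤ r (A.D b) := by
  induction n generalizing x with
  | zero => rw [hn, Function.iterate_zero_apply] at hlt; omega
  | succ n ih =>
    rw [Function.iterate_succ_apply] at hn
    have hxμ : x ≠ μ := by
      rintro rfl
      have := h.bot_le τ hτ
      omega
    have hDx := h.D_mem x hx hxμ
    -- Descend the orbit until the arc from `x` to `D x` spans `b` or starts there; non-crossing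
    -- then confines the arc of `b`.
    by_cases hle : r b ≤ r (A.D x)
    · exact ih hDx hn hle
    · have hτx : r τ ≤ r (A.D x) := by
        -- Intermediate states can leave `T` only after passing `μ`; if the orbit ends in `T`, it
        -- then ends at `μ`, by antisymmetry.
        have : ∀ (n : ℕ) (y : S), y ∈ T → A.D^[n] y ∈ T → r (A.D^[n] y) ≤ r y := by
          intro n
          induction n with
          | zero => exact fun _ _ _ => le_rfl
          | succ n ih' =>
            intro y hy hny
            rw [Function.iterate_succ_apply] at hny ⊢
            by_cases hyμ : y = μ
            · subst hyμ
              have hle := (h.bot_leD hny)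
              have h2 : A.leD (A.D^[n] (A.D y)) y := ⟨n + 1, rfl⟩
              rw [leD.antisymm h2 hle]
            · exact (ih' _ (h.D_mem y hy hyμ) hny).trans (h.D_lt y hy hyμ).le
        rw [hn]
        exact this n _ hDx (hn ▸ hτ)
      rcases hbx.lt_or_eq with hlt' | heq
      · have := h.D_le_D x hx b hb hxμ hlt' (by omega)
        omega
      · rwa [h.injOn hb hx heq]

/-- Rankings for the loops `(μ, π)` and `(κ, ν)` combine if `U π = ν` and if `D κ` lies on the
`D`-orbit of `π`. -/
theorem append [DecidablePred (· ∈ T)] {π κ : S} {T' : Set S} {r' : S → ℕ}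
    (h : A.IsBookRanking μ π T r) (h' : A.IsBookRanking κ ν T' r')
    (hdisj : ∀ a ∈ T, a ∉ T') (hU : A.U π = ν) (hD : A.D κ ∈ T) (hDκ : A.leD (A.D κ) π) :
    A.IsBookRanking μ ν (T ∪ T') (fun a => if a ∈ T then r a else r π + 1 + r' a) := by
  have hdisj' : ∀ a ∈ T', a ∉ T := fun a ha ha' => hdisj a ha' ha
  have hν := hdisj' ν h'.top_mem
  have hκ := hdisj' κ h'.bot_mem
  have hμ := h.bot_mem
  constructor
  · exact Or.inl hμ
  · exact Or.inr h'.top_mem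
  · rintro a (ha | ha) b (hb | hb) hab
    · simp only [ha, hb, if_true] at hab
      exact h.injOn ha hb hab
    · simp only [ha, hdisj' b hb, if_true, if_false] at hab
      have := h.le_top a ha
      omega
    · simp only [hb, hdisj' a ha, if_true, if_false] at hab
      have := h.le_top b hb
      omega
    · simp only [hdisj' a ha, hdisj' b hb, if_false] at hab
      exact h'.injOn ha hb (by omega)
  · rintro a (ha | ha)
    · simpa [hμ, ha] using h.bot_le a ha
    · have := h.le_top μ hμ
      simp only [hμ, hdisj' a ha, if_true, if_false]
      omega
  · rintro a (ha | ha)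
    · have := h.le_top a ha
      simp only [ha, hν, if_true, if_false]
      omega
    · simpa [hν, hdisj' a ha] using h'.le_top a ha
  · rintro a (ha | ha) hne
    · by_cases haπ : a = π
      · rw [haπ, hU]; exact Or.inr h'.top_mem
      · exact Or.inl (h.U_mem a ha haπ)
    · exact Or.inr (h'.U_mem a ha hne)
  · rintro a (ha | ha) hne
    · by_cases haπ : a = π
      · have := h.le_top a ha
        simp only [haπ ▸ ha, haπ, hU, hν, if_true, if_false]
        omega
      · simpa only [ha, h.U_mem a ha haπ, if_true] using h.lt_U a ha haπ
    · simpa [hdisj' a ha, hdisj' _ (h'.U_mem a ha hne)] using h'.lt_U a ha hne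
  · rintro a (ha | ha) hne
    · exact Or.inl (h.D_mem a ha hne)
    · by_cases haκ : a = κ
      · rw [haκ]; exact Or.inl hD
      · exact Or.inr (h'.D_mem a ha haκ)
  · rintro a (ha | ha) hne
    · simpa only [ha, h.D_mem a ha hne, if_true] using h.D_lt a ha hne
    · by_cases haκ : a = κ
      · have := h.le_top _ hD
        simp only [haκ, hκ, hD, if_true, if_false]
        omega
      · simpa [hdisj' a ha, hdisj' _ (h'.D_mem a ha haκ)] using h'.D_lt a ha haκ
  · rintro a (ha | ha) b (hb | hb) hne hab hba
    · have haπ : a ≠ π := by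
        rintro rfl
        have := h.le_top b hb
        simp only [ha, hb, if_true] at hab
        omega
      have haU := h.U_mem a ha haπ
      simp only [ha, hb, haU, if_true] at hab hba ⊢
      have hbπ : b ≠ π := by
        rintro rfl
        have := h.le_top _ haU
        omega
      simpa only [h.U_mem b hb hbπ, if_true] using h.U_le_U a ha b hb haπ hab hba
    -- The only `U`-arc from `T` into `T'` starts at `π`; it ends at the top `ν`, so nothing can
    -- cross over it.
    · have haπ : a = π := by
        by_contra haπ
        have haU := h.U_mem a ha haπ
        have := h.le_top _ haU
        simp only [haU, hdisj' b hb, if_true, if_false] at hba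
        omega
      subst haπ
      rw [hU] at hba ⊢
      have hbν : b ≠ ν := by
        rintro rfl
        omega
      have hbU := h'.U_mem b hb hbν
      have := h'.le_top _ hbU
      simp only [hdisj' _ hbU, hν, if_false]
      omega
    · have := h.le_top b hb
      simp only [hdisj' a ha, hb, if_true, if_false] at hab
      omega
    · have haU := h'.U_mem a ha hne
      simp only [hdisj' a ha, hdisj' b hb, hdisj' _ haU, if_false] at hab hba ⊢
      have hbν : b ≠ ν := by
        rintro rfl
        have := h'.le_top _ haU
        omega
      have := h'.U_le_U a ha b hb hne (by omega) (by omega)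
      simp only [hdisj' _ (h'.U_mem b hb hbν), if_false]
      omega
  · rintro a (ha | ha) b (hb | hb) hne hab hba
    · have haD := h.D_mem a ha hne
      simp only [ha, hb, haD, if_true] at hab hba ⊢
      have hbμ : b ≠ μ := by
        rintro rfl
        have := h.bot_le _ haD
        omega
      simpa only [h.D_mem b hb hbμ, if_true] using h.D_le_D a ha b hb hne hab hba
    · have := h.le_top a ha
      simp only [ha, hdisj' b hb, if_true, if_false] at hab
      omega
    -- The only `D`-arc from `T'` into `T` starts at `κ`. Its target is uncovered, so the arcs of
    -- `T` starting under it stay under it.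
    · have haκ : a = κ := by
        by_contra haκ
        have haD := h'.D_mem a ha haκ
        have := h.le_top b hb
        simp only [hdisj' _ haD, hb, if_true, if_false] at hba
        omega
      subst haκ
      simp only [hD, hb, if_true] at hba ⊢
      have hbμ : b ≠ μ := by
        rintro rfl
        have := h.bot_le _ hD
        omega
      obtain ⟨n, hn⟩ := hDκ
      simpa only [h.D_mem b hb hbμ, if_true] using
        h.le_D_of_lt hD n h.top_mem hn hb (h.le_top b hb) hba
    · have haκ : a ≠ κ := by
        rintro rfl
        have := h'.bot_le b hb
        simp only [hdisj' a ha, hdisj' b hb, if_false] at hab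
        omega
      have haD := h'.D_mem a ha haκ
      simp only [hdisj' a ha, hdisj' b hb, hdisj' _ haD, if_false] at hab hba ⊢
      have hbκ : b ≠ κ := by
        rintro rfl
        have := h'.bot_le _ haD
        omega
      have := h'.D_le_D a ha b hb haκ (by omega) (by omega)
      simp only [hdisj' _ (h'.D_mem b hb hbκ), if_false]
      omega

theorem reachable_subset (h : A.IsBookRanking μ ν T r) : A.reachable μ ν ⊆ T := by
  rintro _ ⟨ε, Φ, ⟨hε, hup, hdown, htransit⟩, rfl⟩
  have hstep : ∀ a ∈ T, ∀ s : AQSStep, (s = .up → a ≠ ν) → (s = .down → a ≠ μ) →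
      A.step s a ∈ T := by
    rintro a ha (_ | _) h1 h2
    · exact h.U_mem a ha (h1 rfl)
    · exact h.D_mem a ha (h2 rfl)
  have key : ∀ k ≤ Φ.length, A.run (Φ.take k) ε ∈ T := by
    intro k
    induction k with
    | zero =>
      intro _
      rcases hε with rfl | rfl
      · exact h.bot_mem
      · exact h.top_mem
    | succ k ih =>
      intro hk
      have hrun : A.run (Φ.take (k + 1)) ε = A.step Φ[k] (A.run (Φ.take k) ε) := by
        unfold run
        rw [List.take_succ_eq_append_getElem hk, List.foldl_append]
        rfl
      rw [hrun]
      apply hstep _ (ih (by omega))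
      · intro hs
        rcases Nat.eq_zero_or_pos k with rfl | hpos
        · exact hup (by rw [List.head?_eq_getElem?, List.getElem?_eq_getElem hk, hs])
        · exact (htransit k hpos hk).2
      · intro hs
        rcases Nat.eq_zero_or_pos k with rfl | hpos
        · exact hdown (by rw [List.head?_eq_getElem?, List.getElem?_eq_getElem hk, hs])
        · exact (htransit k hpos hk).1
  simpa using key _ le_rfl

end IsBookRanking

/-! ### Recursive decomposition of a loop -/

theorem IsLoop.exists_isBookRanking (hA : A.HasLoopRPM) {μ ν : S} (hloop : A.IsLoop μ ν) :
    ∃ (T : Set S) (r : S → ℕ), A.IsBookRanking μ ν T r := by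
  classical
  by_cases hne : μ = ν
  · subst hne
    exact ⟨_, _, isBookRanking_singleton μ⟩
  have hlt : A.loopLt μ ν := ⟨⟨hloop.1, hne⟩, ⟨hloop.2, hne⟩⟩
  obtain ⟨π, hμπ, hπν, hU⟩ : ∃ π, A.leU μ π ∧ π ≠ ν ∧ A.U π = ν := by
    obtain ⟨n, hn⟩ := hloop.1
    obtain ⟨i, j, h1, h2, h3⟩ := exists_iterate_entry A.U {ν} n μ hne hn.symm
    exact ⟨_, ⟨i, rfl⟩, h1, h2⟩
  have hπltν : A.ltU π ν := ⟨⟨1, hU.symm⟩, hπν⟩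
  have hloop₁ : A.IsLoop μ π := by
    by_cases hμ : μ = π
    · exact hμ ▸ ⟨leU_refl _, leD_refl _⟩
    · have := (hA μ ν π hlt).1 ⟨hμπ, hμ⟩ hπltν
      exact ⟨this.1.1, this.2.1⟩
  have hF₁ : A.Fplus π < A.Fplus ν := hπltν.Fplus_lt
  -- The first subloop lowers the upper endpoint, the second raises the lower one; each shrinks one
  -- summand of the measure and fixes the other.
  have hdec₁ : {x | A.Fplus x < A.Fplus π}.ncard < {x | A.Fplus x < A.Fplus ν}.ncard := by
    have := A.finite
    exact Set.ncard_lt_ncard ((Set.ssubset_iff_of_subset fun x hx => lt_trans hx hF₁).2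
      ⟨π, hF₁, fun hx => lt_irrefl (A.Fplus π) hx⟩) (Set.toFinite _)
  obtain ⟨T, r, h⟩ := IsLoop.exists_isBookRanking hA hloop₁
  have hνT : ν ∉ T := fun hν => hπν (leU.antisymm hπltν.1 (h.leU_top hν))
  obtain ⟨κ, hκν, hμκ, hκT, hDκ⟩ : ∃ κ, A.leD κ ν ∧ A.leD μ κ ∧ κ ∉ T ∧ A.D κ ∈ T := by
    obtain ⟨n, hn⟩ := hloop.2
    obtain ⟨i, j, h1, h2, h3⟩ := exists_iterate_entry A.D T n ν hνT (hn ▸ h.bot_mem)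
    refine ⟨_, ⟨i, rfl⟩, ⟨1 + j, ?_⟩, h1, h2⟩
    rw [← Function.iterate_add_apply, hn]
    congr 1
    omega
  have hμκne : μ ≠ κ := fun e => hκT (e ▸ h.bot_mem)
  have hloop₂ : A.IsLoop κ ν := by
    by_cases hκ : κ = ν
    · exact hκ ▸ ⟨leU_refl _, leD_refl _⟩
    · have := (hA μ ν κ hlt).2 ⟨hμκ, hμκne⟩ ⟨hκν, hκ⟩
      exact ⟨this.1.1, this.2.1⟩
  have hF₂ : A.Fminus μ < A.Fminus κ := ltD.Fminus_lt ⟨hμκ, hμκne⟩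
  have hdec₂ : {x | A.Fminus κ < A.Fminus x}.ncard < {x | A.Fminus μ < A.Fminus x}.ncard := by
    have := A.finite
    exact Set.ncard_lt_ncard ((Set.ssubset_iff_of_subset fun x hx => lt_trans hF₂ hx).2
      ⟨κ, hF₂, fun hx => lt_irrefl (A.Fminus κ) hx⟩) (Set.toFinite _)
  obtain ⟨T', r', h'⟩ := IsLoop.exists_isBookRanking hA hloop₂
  refine ⟨_, _, h.append h' ?_ hU hDκ ?_⟩
  · intro a ha ha'
    -- From a common state the `D`-orbit reaches `κ`, outside `T`. It can leave `T` only through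
    -- `μ`, so `κ` would lie below `μ`.
    obtain ⟨n, hn⟩ := h'.bot_leD ha'
    obtain ⟨i, j, h1, h2, h3⟩ := exists_iterate_entry A.D Tᶜ n a (by simpa using ha) (hn ▸ hκT)
    have hx : A.D^[i] a = μ := by
      by_contra hx
      exact h2 (h.D_mem _ (by simpa using h1) hx)
    have hκμ : A.leD κ μ := ⟨j + 1, by
      rw [← hx, ← Function.iterate_add_apply, hn]
      congr 1
      omega⟩
    exact hμκne (leD.antisymm hμκ hκμ)
  · by_cases hτμ : A.D κ = μ
    · rw [hτμ]; exact hloop₁.2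
    by_cases hτπ : A.D κ = π
    · rw [hτπ]; exact leD_refl _
    have hτν : A.ltD (A.D κ) ν := ⟨leD.trans ⟨1, rfl⟩ hκν, fun e => hνT (e ▸ hDκ)⟩
    -- ℓRPM is used on both branches: first `(D κ, ν)` is a loop, then so is `(D κ, π)`.
    have h1 := (hA μ ν _ hlt).2 ⟨h.bot_leD hDκ, Ne.symm hτμ⟩ hτν
    exact ((hA _ ν π h1).1 ⟨h.leU_top hDκ, hτπ⟩ hπltν).2.1
termination_by {x | A.Fplus x < A.Fplus ν}.ncard + {x | A.Fminus μ < A.Fminus x}.ncard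

/-! ### Parabolic arcs and closed curves -/

/-- The curve from `(x, 0)` to `(y, 0)` that is a parabola if `x ≠ y`, above the line for `ε = 1`
and below it for `ε = -1`, and for `x = y` a closed curve to the right, respectively left, of `x`. -/
noncomputable def bookCurve (x y ε : ℝ) : C(unitInterval, EuclideanSpace ℝ (Fin 2)) where
  toFun t := !₂[x + t * (y - x) + ε * (if x = y then (t : ℝ) * (1 - t) else 0),
    -- The factor `(y - x) ^ 2` makes the height at abscissa `X` equal to `ε * ((X - x) * (y - X))`,
    -- so nested arcs can be compared.
    ε * ((t : ℝ) * (1 - t) * (if x = y then 1 - 2 * (t : ℝ) else (y - x) ^ 2))]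
  continuous_toFun := by
    refine (PiLp.continuous_toLp 2 _).comp (continuous_pi fun i => ?_)
    fin_cases i
    · by_cases h : x = y <;> simp [h] <;> fun_prop
    · by_cases h : x = y <;> simp [h] <;> fun_prop

theorem bookCurve_zero (x y ε : ℝ) : bookCurve x y ε 0 = !₂[x, 0] := by
  simp [bookCurve]

theorem bookCurve_one (x y ε : ℝ) : bookCurve x y ε 1 = !₂[y, 0] := by
  simp [bookCurve]

theorem bookCurve_self (x ε : ℝ) (t : unitInterval) :
    bookCurve x x ε t = !₂[x + ε * (t * (1 - t)), ε * (t * (1 - t) * (1 - 2 * t))] := by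
  simp [bookCurve]

theorem bookCurve_of_ne {x y : ℝ} (h : x ≠ y) (ε : ℝ) (t : unitInterval) :
    bookCurve x y ε t = !₂[x + t * (y - x), ε * (t * (1 - t) * (y - x) ^ 2)] := by
  simp [bookCurve, h]

theorem vec_two_inj {a b c d : ℝ} :
    (!₂[a, b] : EuclideanSpace ℝ (Fin 2)) = !₂[c, d] ↔ a = c ∧ b = d := by
  refine ⟨fun h => ⟨?_, ?_⟩, fun h => by rw [h.1, h.2]⟩
  · simpa using congrArg (fun v : EuclideanSpace ℝ (Fin 2) => v 0) h
  · simpa using congrArg (fun v : EuclideanSpace ℝ (Fin 2) => v 1) h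

/-- Injectivity of the closed curves on the open interval. -/
theorem loop_param_inj {s t : ℝ} (hs : 0 < s) (hs' : s < 1)
    (h1 : s * (1 - s) = t * (1 - t)) (h2 : s * (1 - s) * (1 - 2 * s) = t * (1 - t) * (1 - 2 * t)) :
    s = t := by
  rw [← h1] at h2
  have hpos : 0 < s * (1 - s) := mul_pos hs (by linarith)
  have := mul_left_cancel₀ hpos.ne' h2
  linarith

/-- Of two nested parabolas over a line the outer one lies above the inner one. -/
theorem nested_parabola_lt {lo hi lo' hi' X : ℝ} (h1 : lo' < X) (h2 : X < hi')
    (h3 : lo ≤ lo') (h4 : hi' ≤ hi) (hne : lo ≠ lo' ∨ hi' ≠ hi) :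
    (X - lo') * (hi' - X) < (X - lo) * (hi - X) := by
  rcases hne with hne | hne
  · have := h3.lt_of_ne hne
    nlinarith [mul_pos (sub_pos.2 this) (sub_pos.2 h2),
      mul_nonneg (sub_nonneg.2 (h3.trans h1.le)) (sub_nonneg.2 h4)]
  · have := h4.lt_of_ne hne
    nlinarith [mul_pos (sub_pos.2 this) (sub_pos.2 h1),
      mul_nonneg (sub_nonneg.2 (h2.le.trans h4)) (sub_nonneg.2 h3)]

/-! ### The plane drawing of a book ranking -/

namespace IsBookRanking

variable {μ ν : S} {T : Set S} {r : S → ℕ}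

/-- Arcs over a common abscissa are nested by `U_le_U`. They may share the right end, but distinct
left ends already make the heights differ. -/
theorem not_U_arcs_meet (h : A.IsBookRanking μ ν T r) {a b : S} (ha : a ∈ T) (hb : b ∈ T)
    (haν : a ≠ ν) (hab : r a < r b) {X : ℝ} (h1 : (r b : ℝ) < X)
    (h2 : X < r (A.U b)) (h3 : X < r (A.U a))
    (hX : (X - r a) * (r (A.U a) - X) = (X - r b) * (r (A.U b) - X)) : False := by
  have hlt : r b < r (A.U a) := by exact_mod_cast h1.trans h3
  have hle := h.U_le_U a ha b hb haν hab hlt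
  have := nested_parabola_lt (lo := r a) (hi := r (A.U a)) h1 h2 (by exact_mod_cast hab.le)
    (by exact_mod_cast hle) (Or.inl (by exact_mod_cast hab.ne))
  linarith

theorem not_D_arcs_meet (h : A.IsBookRanking μ ν T r) {a b : S} (ha : a ∈ T) (hb : b ∈ T)
    (haμ : a ≠ μ) (hab : r b < r a) {X : ℝ} (h1 : X < r b)
    (h2 : (r (A.D b) : ℝ) < X) (h3 : (r (A.D a) : ℝ) < X)
    (hX : (X - r (A.D a)) * (r a - X) = (X - r (A.D b)) * (r b - X)) : False := by
  have hlt : r (A.D a) < r b := by exact_mod_cast h3.trans h1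
  have hle := h.D_le_D a ha b hb haμ hab hlt
  have := nested_parabola_lt (lo := r (A.D a)) (hi := r a) h2 h1 (by exact_mod_cast hle)
    (by exact_mod_cast hab.le) (Or.inr (by exact_mod_cast hab.ne))
  linarith

/-- The curve that represents a transition in the drawing given by a ranking. -/
noncomputable def transitionCurve (A : AQSAutomaton S) (r : S → ℕ) (e : S × AQSStep) :
    C(unitInterval, EuclideanSpace ℝ (Fin 2)) :=
  bookCurve (r e.1) (r (A.step e.2 e.1)) (match e.2 with | .up => 1 | .down => -1)

/-- The four possible positions of an interior point of the curve of a transition. -/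
theorem transitionCurve_cases (h : A.IsBookRanking μ ν T r) {e : S × AQSStep} (he : e.1 ∈ T)
    (he' : A.step e.2 e.1 ∈ T) {t : unitInterval} (ht : t ∈ Set.Ioo (0 : unitInterval) 1) :
    ∃ X Y : ℝ, transitionCurve A r e t = !₂[X, Y] ∧
      ((e = (ν, .up) ∧ X = r ν + t * (1 - t) ∧ Y = t * (1 - t) * (1 - 2 * t) ∧ r ν < X) ∨
      (e = (μ, .down) ∧ X = r μ - t * (1 - t) ∧ Y = -(t * (1 - t) * (1 - 2 * t)) ∧ X < r μ) ∨
      (e.2 = .up ∧ e.1 ≠ ν ∧ X = r e.1 + t * (r (A.U e.1) - r e.1) ∧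
        Y = (X - r e.1) * (r (A.U e.1) - X) ∧ r e.1 < X ∧ X < r (A.U e.1) ∧
        r μ < X ∧ X < r ν ∧ 0 < Y) ∨
      (e.2 = .down ∧ e.1 ≠ μ ∧ X = r e.1 + t * (r (A.D e.1) - r e.1) ∧
        Y = -((X - r (A.D e.1)) * (r e.1 - X)) ∧ r (A.D e.1) < X ∧ X < r e.1 ∧
        r μ < X ∧ X < r ν ∧ Y < 0)) := by
  obtain ⟨a, k⟩ := e
  have ht0 : (0 : ℝ) < t := ht.1
  have ht1 : (t : ℝ) < 1 := ht.2
  have hpos : (0 : ℝ) < t * (1 - t) := mul_pos ht0 (sub_pos.2 ht1)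
  cases k with
  | up =>
    change A.U a ∈ T at he'
    by_cases hne : a = ν
    · subst hne
      refine ⟨_, _, ?_, Or.inl ⟨rfl, rfl, rfl, by linarith⟩⟩
      have := h.U_top_eq he'
      simp only [transitionCurve, step, this, bookCurve_self, one_mul]
    · have hlt : (r a : ℝ) < r (A.U a) := by exact_mod_cast h.lt_U a he hne
      have hμ : (r μ : ℝ) ≤ r a := by exact_mod_cast h.bot_le a he
      have hν : (r (A.U a) : ℝ) ≤ r ν := by exact_mod_cast h.le_top _ he'
      -- `h1` and `h2` bound the horizontal distances to the two ends; their product is the height.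
      have h1 : 0 < (t : ℝ) * (r (A.U a) - r a) := mul_pos ht0 (sub_pos.2 hlt)
      have h2 : 0 < (1 - (t : ℝ)) * (r (A.U a) - r a) := mul_pos (sub_pos.2 ht1) (sub_pos.2 hlt)
      refine ⟨_, _, bookCurve_of_ne hlt.ne _ t, Or.inr (Or.inr (Or.inl
        ⟨rfl, hne, rfl, ?_, ?_, ?_, ?_, ?_, ?_⟩))⟩ <;>
        first | linarith | nlinarith only [mul_pos h1 h2]
  | down =>
    change A.D a ∈ T at he'
    by_cases hne : a = μ
    · subst hne
      refine ⟨_, _, ?_, Or.inr (Or.inl ⟨rfl, rfl, rfl, by linarith⟩)⟩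
      have := h.D_bot_eq he'
      simp only [transitionCurve, step, this, bookCurve_self, neg_one_mul, ← sub_eq_add_neg]
    · have hlt : (r (A.D a) : ℝ) < r a := by exact_mod_cast h.D_lt a he hne
      have hν : (r a : ℝ) ≤ r ν := by exact_mod_cast h.le_top a he
      have hμ : (r μ : ℝ) ≤ r (A.D a) := by exact_mod_cast h.bot_le _ he'
      have h1 : 0 < (t : ℝ) * (r a - r (A.D a)) := mul_pos ht0 (sub_pos.2 hlt)
      have h2 : 0 < (1 - (t : ℝ)) * (r a - r (A.D a)) := mul_pos (sub_pos.2 ht1) (sub_pos.2 hlt)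
      refine ⟨_, _, bookCurve_of_ne hlt.ne' _ t, Or.inr (Or.inr (Or.inr
        ⟨rfl, hne, rfl, ?_, ?_, ?_, ?_, ?_, ?_⟩))⟩ <;>
        first | linarith | nlinarith only [mul_pos h1 h2]

theorem mem_of_mem_edgeSet {R : Set S} {e : S × AQSStep}
    (he : e ∈ (A.transitionGraph R).edgeSet) : e.1 ∈ R ∧ A.step e.2 e.1 ∈ R := by
  obtain ⟨x, y, hx, hy, ⟨h1, h2⟩ | ⟨h1, h2⟩⟩ := (Graph.edge_mem_iff_exists_isLink _ _).1 he
  · exact ⟨h1 ▸ hx, h2 ▸ hy⟩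
  · exact ⟨h1 ▸ hy, h2 ▸ hx⟩

/-- A ranking yields a plane drawing of the transition graph on every subset. -/
theorem isPlanar (h : A.IsBookRanking μ ν T r) {R : Set S} (hR : R ⊆ T) :
    (A.transitionGraph R).IsPlanar := by
  refine ⟨⟨fun a => !₂[(r a : ℝ), 0], transitionCurve A r, ?_, ?_, ?_, ?_⟩⟩
  · intro a ha b hb hab
    exact h.injOn (hR ha) (hR hb) (by exact_mod_cast (vec_two_inj.1 hab).1)
  · intro e he
    obtain ⟨h1, h2⟩ := mem_of_mem_edgeSet he
    exact ⟨e.1, A.step e.2 e.1, ⟨h1, h2, Or.inl ⟨rfl, rfl⟩⟩, bookCurve_zero _ _ _,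
      bookCurve_one _ _ _⟩
  · intro e he t ht x hx hxt
    obtain ⟨h1, h2⟩ := mem_of_mem_edgeSet he
    obtain ⟨X, Y, hXY, hc⟩ := h.transitionCurve_cases (hR h1) (hR h2) ht
    rw [hXY] at hxt
    obtain ⟨rfl, rfl⟩ := vec_two_inj.1 hxt
    have hμ : (r μ : ℝ) ≤ r x := by exact_mod_cast h.bot_le x (hR hx)
    have hν : (r x : ℝ) ≤ r ν := by exact_mod_cast h.le_top x (hR hx)
    rcases hc with ⟨-, -, -, hc⟩ | ⟨-, -, -, hc⟩ | ⟨-, -, -, -, -, -, -, -, hc⟩ |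
      ⟨-, -, -, -, -, -, -, -, hc⟩ <;> linarith
  · intro e he f hf s hs t ht hst
    obtain ⟨he1, he2⟩ := mem_of_mem_edgeSet he
    obtain ⟨hf1, hf2⟩ := mem_of_mem_edgeSet hf
    obtain ⟨X, Y, hXY, hc⟩ := h.transitionCurve_cases (hR he1) (hR he2) hs
    obtain ⟨X', Y', hXY', hc'⟩ := h.transitionCurve_cases (hR hf1) (hR hf2) ht
    rw [hXY, hXY'] at hst
    obtain ⟨rfl, rfl⟩ := vec_two_inj.1 hst
    have hμν : (r μ : ℝ) ≤ r ν := by exact_mod_cast h.bot_le ν h.top_mem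
    have hs0 : (0 : ℝ) < s := hs.1
    have hs1 : (s : ℝ) < 1 := hs.2
    -- Curves of different types are separated by the sign of the height or by the vertical lines
    -- through `μ` and `ν`; only the four equal-type cases survive.
    rcases hc with ⟨he3, hX, hY, hc⟩ | ⟨he3, hX, hY, hc⟩ | ⟨hk, hne, hX, hY, hl, hu, hc⟩ |
      ⟨hk, hne, hX, hY, hl, hu, hc⟩ <;>
    rcases hc' with ⟨hf3, hX', hY', hc'⟩ | ⟨hf3, hX', hY', hc'⟩ |
      ⟨hk', hne', hX', hY', hl', hu', hc'⟩ | ⟨hk', hne', hX', hY', hl', hu', hc'⟩ <;>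
    try (exfalso; linarith)
    · exact ⟨he3.trans hf3.symm, Subtype.ext (loop_param_inj hs0 hs1 (by linarith)
        (by linarith))⟩
    · exact ⟨he3.trans hf3.symm, Subtype.ext (loop_param_inj hs0 hs1 (by linarith)
        (by linarith))⟩
    · have hr : r e.1 = r f.1 := by
        rcases lt_trichotomy (r e.1) (r f.1) with hlt | heq | hlt
        · exact (h.not_U_arcs_meet (hR he1) (hR hf1) hne hlt hl' hu' hu (by linarith)).elim
        · exact heq
        · exact (h.not_U_arcs_meet (hR hf1) (hR he1) hne' hlt hl hu hu' (by linarith)).elim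
      have hef := h.injOn (hR he1) (hR hf1) hr
      refine ⟨Prod.ext hef (hk.trans hk'.symm), Subtype.ext ?_⟩
      rw [← hef] at hX'
      exact mul_right_cancel₀ (b := (r (A.U e.1) : ℝ) - r e.1) (by linarith) (by linarith)
    · have hr : r e.1 = r f.1 := by
        rcases lt_trichotomy (r e.1) (r f.1) with hlt | heq | hlt
        · exact (h.not_D_arcs_meet (hR hf1) (hR he1) hne' hlt hu hl hl' (by linarith)).elim
        · exact heq
        · exact (h.not_D_arcs_meet (hR he1) (hR hf1) hne hlt hu' hl' hl (by linarith)).elim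
      have hef := h.injOn (hR he1) (hR hf1) hr
      refine ⟨Prod.ext hef (hk.trans hk'.symm), Subtype.ext ?_⟩
      rw [← hef] at hX'
      have hlt := hl.trans hu
      exact mul_right_cancel₀ (b := (r (A.D e.1) : ℝ) - r e.1) (sub_neg.2 hlt).ne (by linarith)

end IsBookRanking

end AQSAutomaton

theorem mainTheorem2 {S : Type*} (A : AQSAutomaton S) (hA : A.HasLoopRPM)
    (μ ν : S) (hloop : A.IsLoop μ ν) :
    (A.transitionGraph (A.reachable μ ν)).IsPlanar := by
  obtain ⟨T, r, h⟩ := hloop.exists_isBookRanking hA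
  exact h.isPlanar h.reachable_subset
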